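/- Let $\ell,k\ge 0$ be integers and let ${\rm P}^k_\ell$ be the set of $\lambda\in\mathbb Z^\ell$ with $k\ge\lambda_1\ge\cdots\ge\lambda_\ell\ge 0$. Write $[a,b]=\{a,\dots,b\}$ (empty if $a>b$), $[b]=[1,b]$, and let $\epsilon_i\in\mathbb Z^\ell$ be the $i$-th unit vector. **Katalan functions.** Let $h_d$ be the complete homogeneous symmetric functions. For $r\ge0$ and $m\in\mathbb Z$ put $k_m^{(r)}=\sum_{i=0}^m\binom{r+i-1}{i}h_{m-i}$ (so $k_m^{(r)}=0$ for $m<0$ and $k_m^{(0)}=h_m$), and for $\gamma\in\mathbb Z^\ell$ put $g_\gamma=\det\big(k^{(i-1)}_{\gamma_i+j-i}\big)_{1\le i,j\le\ell}$. Let $\Delta_\ell^+=\{(i,j):1\le i<j\le\ell\}$; a root ideal is a set $\Psi\subseteq\Delta^+_\ell$ such that $(a,b)\in\Psi$, $(c,d)\in\Delta^+_\ell$, $c\le a$, $b\le d$ imply $(c,d)\in\Psi$. For a root ideal $\Psi$, a multiset $M$ on $[\ell]$ and $\gamma\in\mathbb Z^\ell$ put $$K(\Psi;M;\gamma)=\prod_{m\in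 M}(1-L_m)\prod_{(i,j)\in\Psi}(1-R_{ij})^{-1}g_\gamma,$$ where the operators act on the index $\gamma$ by $L_m:\gamma\mapsto\gamma-\epsilon_m$ and $R_{ij}:\gamma\mapsto\gamma+\epsilon_i-\epsilon_j$, and $(1-R_{ij})^{-1}=\sum_{n\ge0}R_{ij}^n$ (only finitely many terms are nonzero). Accordingly $L_xK(\Psi;M;\gamma)=K(\Psi;M;\gamma-\epsilon_x)$. **Weighted functions.** For $\lambda\in{\rm P}^k_\ell$ let $\Delta^k(\lambda)=\{(i,j)\in\Delta^+_\ell: k-\lambda_i+i<j\}$, a root ideal. Let $b_\lambda$ be the largest $i$ such that some $(i,j)$ lies in $\Delta^k(\lambda)$ ($b_\lambda=0$ if $\Delta^k(\lambda)=\emptyset$), and let $L(\Delta^k(\lambda))$ be the multiset of second components of the elements of $\Delta^k(\lambda)$. For $x\in[\ell]$ let $\mathrm{down}_\lambda(x)$ be the unique $j$, if there is one, such that $(x,j)\in\Delta^k(\lambda)$ and $\Delta^k(\lambda)\setminus\{(x,j)\}$ is again a root ideal; otherwise $\mathrm{down}_\lambda(x)$ is undefined. Let $\mathrm{down}_\lambda^a$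 be its $a$-th iterate. The $K$-$k$-Schur function of weight $z$ is $$\mathfrak g_{\lambda}^{[z]}=K\Big(\Delta^k(\lambda);\,L(\Delta^k(\lambda))\setminus\{\mathrm{down}_\lambda(x):x\in[z,b_\lambda]\};\,\lambda\Big).$$ **Proposition 3.3.** Let $\lambda\in{\rm P}^k_\ell$, $z\in[b_\lambda-1]$ and $a\ge1$ be such that $\mathrm{down}_\lambda^a(z)$ is defined and lies in $[b_\lambda]$. Put $\gamma=\lambda-\epsilon_{\mathrm{down}_\lambda^a(z)}$. Then $\mathrm{down}_\lambda^{a+1}(z)$ is defined, and the following hold. (i) If $\gamma\in{\rm P}^k_\ell$, then $$L_{\mathrm{down}_\lambda^a(z)}\,\mathfrak g_\lambda^{[z]}=\big(1-L_{\mathrm{down}_\gamma^{a+1}(z)}\big)\,\mathfrak g_\gamma^{[z]}+L_{\mathrm{down}_\lambda^{a+1}(z)}\,\mathfrak g_\lambda^{[z]},$$ where $L_{\mathrm{down}_\gamma^{a+1}(z)}:=0$ if $\mathrm{down}_\gamma^{a+1}(z)$ is undefined. (ii) If $\gamma\notin{\rm P}^k_\ell$ and $\lambda_z>\lambda_{z+1}$,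 then $$L_{\mathrm{down}_\lambda^a(z)}\,\mathfrak g_\lambda^{[z]}=L_{\mathrm{down}_\lambda^{a+1}(z)}\,\mathfrak g_\lambda^{[z]}.$$ -/

import Mathlib

/-!  Indices: the paper's index set `[ℓ] = {1, …, ℓ}` is `Fin ℓ`; the element `x : Fin ℓ` stands for
the label `x + 1`.  Differences of labels and the order of labels are unaffected by this shift. -/

/-- The complete homogeneous symmetric function `h_d` in the variables `x₀, x₁, x₂, …`: the sum of
all monomials of degree `d`.  The ring `Λ = ℤ[h₁, h₂, …]` of symmetric functions is a subring of
the ring `MvPowerSeries ℕ ℤ`, in which all our symmetric functions live. -/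
noncomputable def hSymm (d : ℕ) : MvPowerSeries ℕ ℤ :=
  fun n => if n.degree = d then 1 else 0

/-- The inhomogeneous version `k_m^{(r)} = ∑_{i=0}^m binom(r+i-1, i) h_{m-i}` of `h_m`, zero for
`m < 0`.  For `r = i = 0` the truncated `0 + 0 - 1 = 0` gives the correct value
`binom(-1, 0) = 1`. -/
noncomputable def kSymm (r : ℕ) (m : ℤ) : MvPowerSeries ℕ ℤ :=
  if m < 0 then 0
  else ∑ i ∈ Finset.range (m.toNat + 1), (r + i - 1).choose i • hSymm (m.toNat - i)

/-- `g_γ = det (k_{γ_i + j - i}^{(i-1)})` for `γ ∈ ℤ^ℓ` (the upper index `i - 1` for the label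
`i` is the underlying number of the element of `Fin ℓ`). -/
noncomputable def gDual {ℓ : ℕ} (γ : Fin ℓ → ℤ) : MvPowerSeries ℕ ℤ :=
  (Matrix.of fun i j : Fin ℓ => kSymm (i : ℕ) (γ i + (j : ℤ) - (i : ℤ))).det

/-- A family of symmetric functions indexed by `ℤ^ℓ`. Lowering and raising operators act
on the index. -/
abbrev SymmFamily (ℓ : ℕ) : Type := (Fin ℓ → ℤ) → MvPowerSeries ℕ ℤ

/-- The lowering operator `L_z`: `(L_z F)_γ = F_{γ - ε_z}`. -/
def lowerOp {ℓ : ℕ} (z : Fin ℓ) (F : SymmFamily ℓ) : SymmFamily ℓ :=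
  fun γ => F (γ - Pi.single z 1)

/-- The operator `1 - L_z`. -/
noncomputable def oneSubLower {ℓ : ℕ} (z : Fin ℓ) (F : SymmFamily ℓ) : SymmFamily ℓ :=
  F - lowerOp z F

instance oneSubLower_leftCommutative {ℓ : ℕ} :
    LeftCommutative (oneSubLower : Fin ℓ → SymmFamily ℓ → SymmFamily ℓ) where
  left_comm x y F := by
    funext γ
    simp only [oneSubLower, lowerOp, Pi.sub_apply, sub_right_comm γ (Pi.single x 1)]
    ring

/-- The operator `∏_{z ∈ M} (1 - L_z)` for a multiset `M` on `[ℓ]`. -/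
noncomputable def lowerProd {ℓ : ℕ} (M : Multiset (Fin ℓ)) (F : SymmFamily ℓ) : SymmFamily ℓ :=
  M.foldr oneSubLower F

/-- `ε_i - ε_j` for `α = (i, j)`. -/
def rootVec {ℓ : ℕ} (α : Fin ℓ × Fin ℓ) : Fin ℓ → ℤ :=
  Pi.single α.1 1 - Pi.single α.2 1

/-- The total shift of the index under `∏_α R_α^{n α}`, where `R_{ij} F_γ = F_{γ + ε_i - ε_j}`. -/
def rootShift {ℓ : ℕ} (n : Fin ℓ × Fin ℓ →₀ ℕ) : Fin ℓ → ℤ :=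
  n.sum fun α c => c • rootVec α

/-- `∏_{α ∈ Ψ} (1 - R_α)⁻¹ g_γ`, expanded by the geometric series `(1 - R_α)⁻¹ = ∑_c R_α^c`, that is,
the sum of `∏_α R_α^{n α} g_γ` over all families `n` of exponents supported on `Ψ`.  Only finitely
many summands are nonzero (`raiseSeries_finite`). -/
noncomputable def raiseSeries {ℓ : ℕ} (Ψ : Finset (Fin ℓ × Fin ℓ)) : SymmFamily ℓ :=
  fun γ => ∑ᶠ n ∈ {n : Fin ℓ × Fin ℓ →₀ ℕ | n.support ⊆ Ψ}, gDual (γ + rootShift n)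

/-- The Katalan functions `K(Ψ; M; γ) = ∏_{z ∈ M} (1 - L_z) ∏_{(i,j) ∈ Ψ} (1 - R_{ij})⁻¹ g_γ`, as a
family indexed by `γ ∈ ℤ^ℓ`. -/
noncomputable def katalan {ℓ : ℕ} (Ψ : Finset (Fin ℓ × Fin ℓ)) (M : Multiset (Fin ℓ)) :
    SymmFamily ℓ :=
  lowerProd M (raiseSeries Ψ)

theorem gDual_eq_zero {ℓ : ℕ} (γ : Fin ℓ → ℤ) (i : Fin ℓ) (h : γ i + ℓ ≤ i) : gDual γ = 0 := by
  unfold gDual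
  refine Matrix.det_eq_zero_of_row_eq_zero i fun j => ?_
  have hj : (j : ℤ) < ℓ := by exact_mod_cast j.isLt
  simp only [Matrix.of_apply, kSymm]
  rw [if_pos (by omega)]

theorem rootShift_moment {ℓ : ℕ} (Ψ : Finset (Fin ℓ × Fin ℓ)) (hΨ : ∀ α ∈ Ψ, α.1 < α.2)
    (n : Fin ℓ × Fin ℓ →₀ ℕ) (hn : n.support ⊆ Ψ) :
    ∑ i : Fin ℓ, (i : ℤ) * rootShift n i ≤ -∑ α ∈ n.support, (n α : ℤ) := by
  have h1 : ∑ i : Fin ℓ, (i : ℤ) * rootShift n i =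
      ∑ α ∈ n.support, (n α : ℤ) * ((α.1 : ℤ) - (α.2 : ℤ)) := by
    simp only [rootShift, Finsupp.sum, Finset.sum_apply, Pi.smul_apply, Finset.mul_sum]
    rw [Finset.sum_comm]
    refine Finset.sum_congr rfl fun α _ => ?_
    simp only [rootVec, Pi.sub_apply, nsmul_eq_mul, mul_sub, Finset.sum_sub_distrib,
      Pi.single_apply]
    simp [mul_comm]
  rw [h1, ← Finset.sum_neg_distrib]
  refine Finset.sum_le_sum fun α hα => ?_
  have h2 : (α.1 : ℤ) < (α.2 : ℤ) := by exact_mod_cast hΨ α (hn hα)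
  nlinarith [Int.natCast_nonneg (n α)]

/-- The sum defining `raiseSeries` has finitely many nonzero terms. -/
theorem raiseSeries_finite {ℓ : ℕ} (Ψ : Finset (Fin ℓ × Fin ℓ)) (hΨ : ∀ α ∈ Ψ, α.1 < α.2)
    (γ : Fin ℓ → ℤ) :
    {n : Fin ℓ × Fin ℓ →₀ ℕ | n.support ⊆ Ψ ∧ gDual (γ + rootShift n) ≠ 0}.Finite := by
  set B : ℤ := ∑ i : Fin ℓ, (i : ℤ) * (γ i + ℓ) with hB
  refine (Set.finite_Iic (Finsupp.equivFunOnFinite.symm fun _ => B.toNat)).subset ?_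
  rintro n ⟨hn, hg⟩ α
  have h1 := rootShift_moment Ψ hΨ n hn
  have h2 : -B ≤ ∑ i : Fin ℓ, (i : ℤ) * rootShift n i := by
    rw [hB, ← Finset.sum_neg_distrib]
    refine Finset.sum_le_sum fun i _ => ?_
    have h3 : ¬ ((γ + rootShift n) i + ℓ ≤ i) := fun h => hg (gDual_eq_zero _ i h)
    simp only [Pi.add_apply] at h3
    have hi : (0 : ℤ) ≤ i := Int.natCast_nonneg _
    nlinarith
  have h4 : (n α : ℤ) ≤ ∑ α ∈ n.support, (n α : ℤ) := by
    by_cases hα : α ∈ n.support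
    · exact Finset.single_le_sum (f := fun α => (n α : ℤ)) (fun _ _ => Int.natCast_nonneg _) hα
    · rw [Finsupp.notMem_support_iff.mp hα]
      exact Finset.sum_nonneg fun _ _ => Int.natCast_nonneg _
  simp only [Finsupp.equivFunOnFinite_symm_apply_apply]
  omega

/-- Root ideals: upper order ideals of `Δ⁺_ℓ = {(i, j) : i < j}`, where `(a, b) ≤ (c, d)` if `a ≥ c`
and `b ≤ d`. -/
def IsRootIdeal {ℓ : ℕ} (Ψ : Finset (Fin ℓ × Fin ℓ)) : Prop :=
  (∀ α ∈ Ψ, α.1 < α.2) ∧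
    ∀ α ∈ Ψ, ∀ β : Fin ℓ × Fin ℓ, β.1 < β.2 → β.1 ≤ α.1 → α.2 ≤ β.2 → β ∈ Ψ

/-- A root `α ∈ Ψ` is removable if `Ψ \ α` is still a root ideal. -/
def IsRemovable {ℓ : ℕ} (Ψ : Finset (Fin ℓ × Fin ℓ)) (α : Fin ℓ × Fin ℓ) : Prop :=
  α ∈ Ψ ∧ IsRootIdeal (Ψ.erase α)

open scoped Classical in
/-- `down_Ψ(x)` is the `j` such that `(x, j)` is removable in `Ψ`; it is undefined (`none`) if there
is no such `j`. (There is at most one, see `IsRemovable.snd_unique`.) -/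
noncomputable def down {ℓ : ℕ} (Ψ : Finset (Fin ℓ × Fin ℓ)) (x : Fin ℓ) : Option (Fin ℓ) :=
  if h : ∃ j, IsRemovable Ψ (x, j) then some h.choose else none

theorem IsRemovable.snd_unique {ℓ : ℕ} {Ψ : Finset (Fin ℓ × Fin ℓ)} {x i j : Fin ℓ}
    (hi : IsRemovable Ψ (x, i)) (hj : IsRemovable Ψ (x, j)) : i = j := by
  have key : ∀ i j : Fin ℓ, IsRemovable Ψ (x, i) → IsRemovable Ψ (x, j) → ¬ i < j := by
    intro i j hi hj hij
    have h1 : (x, i) ∈ Ψ.erase (x, j) := by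
      simp [Finset.mem_erase, hi.1, hij.ne]
    have h2 := hj.2.2 _ h1 (x, j) ((hj.2.1 _ h1).trans hij) le_rfl hij.le
    simp at h2
  exact le_antisymm (not_lt.mp (key j i hj hi)) (not_lt.mp (key i j hi hj))

/-- `down_Ψ^a(x)`, undefined (`none`) as soon as one of the steps is. -/
noncomputable def downIter {ℓ : ℕ} (Ψ : Finset (Fin ℓ × Fin ℓ)) : ℕ → Fin ℓ → Option (Fin ℓ)
  | 0, x => some x
  | a + 1, x => (downIter Ψ a x).bind (down Ψ)

/-- The label (in `{1, …, ℓ}`) of the bottom row of `Ψ`, that is, of the last row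
containing a root; it is `0` if `Ψ` is empty. -/
def bottom {ℓ : ℕ} (Ψ : Finset (Fin ℓ × Fin ℓ)) : ℕ :=
  Ψ.sup fun α => (α.1 : ℕ) + 1

/-- The set `P^k_ℓ` of `k`-bounded partitions of length `ℓ`: `k ≥ λ_1 ≥ ⋯ ≥ λ_ℓ ≥ 0`. -/
def IsBoundedPartition (k : ℕ) {ℓ : ℕ} (lam : Fin ℓ → ℤ) : Prop :=
  Antitone lam ∧ ∀ i, 0 ≤ lam i ∧ lam i ≤ k

/-- `Δ^k(λ) = {(i, j) ∈ Δ⁺_ℓ : k - λ_i + i < j}`. -/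
def rootIdealOf (k : ℕ) {ℓ : ℕ} (lam : Fin ℓ → ℤ) : Finset (Fin ℓ × Fin ℓ) :=
  Finset.univ.filter fun α => α.1 < α.2 ∧ (k : ℤ) - lam α.1 + (α.1 : ℤ) < (α.2 : ℤ)

/-- The multiset `L(Ψ)` of second components of the elements of `Ψ`. -/
def secondComponents {ℓ : ℕ} (Ψ : Finset (Fin ℓ × Fin ℓ)) : Multiset (Fin ℓ) :=
  Ψ.val.map Prod.snd

/-- The multiset `L(Δ^k(λ)) \ {down_λ(x) : x ∈ [z, b_λ]}`, where `b_λ` is the bottom of `Δ^k(λ)`. -/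
noncomputable def weightMultiset (k : ℕ) {ℓ : ℕ} (lam : Fin ℓ → ℤ) (z : Fin ℓ) :
    Multiset (Fin ℓ) :=
  secondComponents (rootIdealOf k lam) -
    (Finset.univ.filter fun x : Fin ℓ =>
      z ≤ x ∧ (x : ℕ) + 1 ≤ bottom (rootIdealOf k lam)).val.filterMap (down (rootIdealOf k lam))

/-- The `K`-`k`-Schur function of weight `z`,
`K(Δ^k(λ); L(Δ^k(λ)) \ {down_λ(x) : x ∈ [z, b_λ]}; λ)`. -/
noncomputable def weightedKkSchur (k : ℕ) {ℓ : ℕ} (lam : Fin ℓ → ℤ) (z : Fin ℓ) :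
    MvPowerSeries ℕ ℤ :=
  katalan (rootIdealOf k lam) (weightMultiset k lam z) lam

/-- `L_y` applied to the `K`-`k`-Schur function of weight `z` of `λ`.  The operator `L_y` acts on the
index of the Katalan function; if `y` is undefined (`none`), then `L_y = 0` by convention. -/
noncomputable def lowerWeightedKkSchur (k : ℕ) {ℓ : ℕ} (y : Option (Fin ℓ)) (lam : Fin ℓ → ℤ)
    (z : Fin ℓ) : MvPowerSeries ℕ ℤ :=
  match y with
  | none => 0
  | some x => lowerOp x (katalan (rootIdealOf k lam) (weightMultiset k lam z)) lam

/-!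
Write `c_i = k - λ_i + i + 1` for the column in which row `i` of `Ψ = Δ^k(λ)` starts (`rowStart`).
The `c_i` increase strictly, so `down_λ(i) = c_i` for every nonempty row, and the weight multiset
`M` consists of the columns of the roots other than the removable ones of the rows from `z` on
(`IsBoundedPartition.weightMultiset_eq`).

Let `y = down_λ^a(z)` and `y' = down_λ(y) = c_y`. Splitting off the geometric series of the
removable root `(y, y')` (`katalan_erase`) gives
`K(Ψ; M; λ - ε_y) = K(Ψ \ (y, y'); M; λ - ε_y) + K(Ψ; M; λ - ε_{y'})`.
The last term is `L_{y'} 𝔤_λ`, so everything depends on the first one.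

If `γ = λ - ε_y` is a bounded partition, then `Ψ \ (y, y') = Δ^k(γ)`, and `M` is the weight multiset
of `γ` with one more element `down_γ(y) = down_γ^(a+1)(z)`, if this is defined; hence (i).

Otherwise `λ_y = λ_{y+1}`, and the first term vanishes. The reason is that `(1 - L_{j+1}) g` changes
sign under the dot action of the transposition of `j` and `j + 1`
(`isDotAntisymm_oneSubLower_gDual`), and so does everything obtained from it by operators that are
symmetric in `j` and `j + 1`; this kills a Katalan function at a fixed point of the dot action
(`katalan_eq_zero`). The multiset `M` has the required form at each pair `j, j + 1` with `j` on the
path of `z` (`IsBoundedPartition.count_weightMultiset_succ`). If the root ideal fails to be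
symmetric in `y` and `y + 1`, one more root restores the symmetry, and the correction
term vanishes by the same argument one step further up the path, where it stops at the latest in
row `z`, as `λ_z > λ_{z+1}` (`IsBoundedPartition.katalan_eq_zero`).
-/

/-! ### The recurrence for `k_m^{(r)}` and the antisymmetry of `(1 - L_{j+1}) g` -/

theorem kSymm_succ (r : ℕ) (m : ℤ) : kSymm (r + 1) m = kSymm r m + kSymm (r + 1) (m - 1) := by
  rcases lt_or_ge m 0 with hm | hm
  · simp [kSymm, hm, show m - 1 < 0 by omega]
  obtain ⟨n, rfl⟩ := Int.eq_ofNat_of_zero_le hm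
  cases n with
  | zero => simp [kSymm]
  | succ n =>
    have h1 : ((n + 1 : ℕ) : ℤ) - 1 = (n : ℤ) := by push_cast; ring
    have h2 : ¬ ((n + 1 : ℕ) : ℤ) < 0 := by omega
    have h3 : ¬ (n : ℤ) < 0 := by omega
    rw [h1]
    simp only [kSymm, if_neg h2, if_neg h3, Int.toNat_natCast]
    rw [Finset.sum_range_succ' _ (n + 1),
      Finset.sum_range_succ' (fun i => (r + i - 1).choose i • hSymm (n + 1 - i)) (n + 1),
      add_right_comm (Finset.sum _ _), ← Finset.sum_add_distrib]
    congr 1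
    · refine Finset.sum_congr rfl fun i _ => ?_
      rw [show r + 1 + (i + 1) - 1 = (r + i) + 1 by omega, show r + (i + 1) - 1 = r + i by omega,
        show r + 1 + i - 1 = r + i by omega, show n + 1 - (i + 1) = n - i by omega,
        Nat.choose_succ_succ, add_smul, add_comm]
    · simp

/-- The dot action of the transposition of `i` and `j` on `ℤ^ℓ`: for `j = i + 1` the fixed points
are the `γ` with `γ_i = γ_j - 1`. -/
def dotSwap {ℓ : ℕ} (i j : Fin ℓ) (γ : Fin ℓ → ℤ) : Fin ℓ → ℤ :=
  γ ∘ Equiv.swap i j - Pi.single i 1 + Pi.single j 1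

theorem dotSwap_add {ℓ : ℕ} (i j : Fin ℓ) (γ v : Fin ℓ → ℤ) :
    dotSwap i j (γ + v) = dotSwap i j γ + v ∘ Equiv.swap i j := by
  funext x
  simp only [dotSwap, Pi.add_apply, Pi.sub_apply, Function.comp_apply]
  ring

theorem single_comp_swap {ℓ : ℕ} (i j x : Fin ℓ) :
    (Pi.single x 1 : Fin ℓ → ℤ) ∘ Equiv.swap i j = Pi.single (Equiv.swap i j x) 1 := by
  funext t
  simp only [Function.comp_apply, Pi.single_apply]
  congr 1
  rw [eq_iff_iff, Equiv.swap_apply_eq_iff]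

theorem dotSwap_eq_self {ℓ : ℕ} {i j : Fin ℓ} (hij : i ≠ j) {γ : Fin ℓ → ℤ}
    (h : γ i = γ j - 1) : dotSwap i j γ = γ := by
  funext x
  simp only [dotSwap, Pi.add_apply, Pi.sub_apply, Function.comp_apply]
  rcases eq_or_ne x i with rfl | hi
  · simp [hij, h]
  rcases eq_or_ne x j with rfl | hj
  · simp [hij.symm, h]
  · simp [Equiv.swap_apply_of_ne_of_ne hi hj, hi, hj]

/-- `F` is antisymmetric under the dot action of the transposition of `i` and `j`. -/
def IsDotAntisymm {ℓ : ℕ} (i j : Fin ℓ) (F : SymmFamily ℓ) : Prop :=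
  ∀ γ, F (dotSwap i j γ) = -F γ

theorem IsDotAntisymm.eq_zero {ℓ : ℕ} {i j : Fin ℓ} {F : SymmFamily ℓ}
    (hF : IsDotAntisymm i j F) (hij : i ≠ j) {γ : Fin ℓ → ℤ} (h : γ i = γ j - 1) : F γ = 0 := by
  have h1 := hF γ
  rw [dotSwap_eq_self hij h] at h1
  ext n
  have h2 := congrArg (MvPowerSeries.coeff n) h1
  simp only [map_neg] at h2
  simp only [map_zero]
  omega

/-- The operator `1 - L_j` turns the superscript `j - 1` of row `j` of the determinant `g_γ` into
the superscript `j - 2` of the row above, so that the dot action interchanges the two rows. -/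
theorem isDotAntisymm_oneSubLower_gDual {ℓ : ℕ} {i j : Fin ℓ} (hij : (j : ℕ) = i + 1) :
    IsDotAntisymm i j (oneSubLower j (gDual (ℓ := ℓ))) := by
  have hne : i ≠ j := by rintro rfl; omega
  let A : (Fin ℓ → ℤ) → Matrix (Fin ℓ) (Fin ℓ) (MvPowerSeries ℕ ℤ) := fun γ =>
    Matrix.of fun a b : Fin ℓ => kSymm (a : ℕ) (γ a + (b : ℤ) - (a : ℤ))
  let B : (Fin ℓ → ℤ) → Matrix (Fin ℓ) (Fin ℓ) (MvPowerSeries ℕ ℤ) := fun γ =>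
    (A γ).updateRow j fun b => kSymm (i : ℕ) (γ j + (b : ℤ) - (j : ℤ))
  have hB : ∀ γ, oneSubLower j (gDual (ℓ := ℓ)) γ = (B γ).det := by
    intro γ
    have h1 : A (γ - Pi.single j 1) =
        (A γ).updateRow j fun b => kSymm (j : ℕ) (γ j + (b : ℤ) - (j : ℤ) - 1) := by
      ext1 a b
      rcases eq_or_ne a j with rfl | ha
      · simp only [A, Matrix.updateRow_self, Matrix.of_apply, Pi.sub_apply, Pi.single_eq_same]
        congr 1; ring
      · simp [A, ha]
    have h2 : A γ = (A γ).updateRow j ((fun b : Fin ℓ => kSymm (i : ℕ) (γ j + (b : ℤ) - (j : ℤ))) +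
        fun b : Fin ℓ => kSymm (j : ℕ) (γ j + (b : ℤ) - (j : ℤ) - 1)) := by
      ext1 a b
      rcases eq_or_ne a j with rfl | ha
      · simp only [A, Matrix.updateRow_self, Matrix.of_apply, Pi.add_apply, hij]
        exact kSymm_succ _ _
      · simp [A, ha]
    have h3 : (A γ).det = (B γ).det + (A (γ - Pi.single j 1)).det := by
      conv_lhs => rw [h2]
      rw [Matrix.det_updateRow_add, h1]
    change (A γ).det - (A (γ - Pi.single j 1)).det = _
    rw [h3, add_sub_cancel_right]
  intro γ
  rw [hB, hB]
  have h : B (dotSwap i j γ) = (B γ).submatrix (Equiv.swap i j) id := by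
    ext1 a b
    simp only [Matrix.submatrix_apply, id]
    rcases eq_or_ne a i with rfl | hi
    · simp only [B, A, Equiv.swap_apply_left, Matrix.updateRow_self, Matrix.updateRow_ne hne,
        Matrix.of_apply, dotSwap, Pi.add_apply, Pi.sub_apply, Function.comp_apply,
        Pi.single_eq_same, Pi.single_eq_of_ne hne]
      congr 1
      rw [hij]; push_cast; ring
    rcases eq_or_ne a j with rfl | hj
    · simp only [B, A, Equiv.swap_apply_right, Matrix.updateRow_self, Matrix.updateRow_ne hne,
        Matrix.of_apply, dotSwap, Pi.add_apply, Pi.sub_apply, Function.comp_apply,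
        Pi.single_eq_same, Pi.single_eq_of_ne hne.symm]
      congr 1
      rw [hij]; push_cast; ring
    · simp [B, A, Equiv.swap_apply_of_ne_of_ne hi hj, dotSwap, hi, hj]
  rw [h, Matrix.det_permute, Equiv.Perm.sign_swap hne]
  simp

/-! ### Lowering operators -/

theorem lowerProd_cons {ℓ : ℕ} (x : Fin ℓ) (M : Multiset (Fin ℓ)) (F : SymmFamily ℓ) :
    lowerProd (x ::ₘ M) F = oneSubLower x (lowerProd M F) :=
  Multiset.foldr_cons _ _ _ _

theorem lowerProd_cons' {ℓ : ℕ} (x : Fin ℓ) (M : Multiset (Fin ℓ)) (F : SymmFamily ℓ) :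
    lowerProd (x ::ₘ M) F = lowerProd M (oneSubLower x F) := by
  induction M using Multiset.induction_on with
  | empty => rfl
  | cons y M ih =>
    rw [lowerProd_cons, lowerProd_cons, LeftCommutative.left_comm (op := oneSubLower),
      ← lowerProd_cons, ih, lowerProd_cons]

theorem lowerProd_add {ℓ : ℕ} (M : Multiset (Fin ℓ)) (F G : SymmFamily ℓ) :
    lowerProd M (F + G) = lowerProd M F + lowerProd M G := by
  induction M using Multiset.induction_on with
  | empty => rfl
  | cons y M ih =>
    simp only [lowerProd_cons, ih]
    funext γ
    simp only [oneSubLower, lowerOp, Pi.sub_apply, Pi.add_apply]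
    ring

theorem lowerProd_translate {ℓ : ℕ} (M : Multiset (Fin ℓ)) (F : SymmFamily ℓ) (v γ : Fin ℓ → ℤ) :
    lowerProd M (fun δ => F (δ + v)) γ = lowerProd M F (γ + v) := by
  induction M using Multiset.induction_on generalizing γ with
  | empty => rfl
  | cons y M ih =>
    simp only [lowerProd_cons, oneSubLower, lowerOp, Pi.sub_apply, ih, sub_add_eq_add_sub]

theorem IsDotAntisymm.lowerProd_dotSwap {ℓ : ℕ} {i j : Fin ℓ} {F : SymmFamily ℓ}
    (hF : IsDotAntisymm i j F) (M : Multiset (Fin ℓ)) (γ : Fin ℓ → ℤ) :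
    lowerProd M F (dotSwap i j γ) = -lowerProd (M.map (Equiv.swap i j)) F γ := by
  induction M using Multiset.induction_on generalizing γ with
  | empty => exact hF γ
  | cons x M ih =>
    have h : dotSwap i j γ - Pi.single x 1 = dotSwap i j (γ - Pi.single (Equiv.swap i j x) 1) := by
      have h1 := dotSwap_add i j (γ - Pi.single (Equiv.swap i j x) 1)
        (Pi.single (Equiv.swap i j x) 1)
      rw [single_comp_swap, Equiv.swap_apply_self, sub_add_cancel] at h1
      rw [h1, add_sub_cancel_right]
    simp only [Multiset.map_cons, lowerProd_cons, oneSubLower, lowerOp, Pi.sub_apply, h, ih]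
    ring

theorem map_swap_eq_self {α : Type*} [DecidableEq α] {i j : α} {M : Multiset α}
    (h : M.count i = M.count j) : M.map (Equiv.swap i j) = M := by
  ext x
  have h1 := Multiset.count_map_eq_count' (Equiv.swap i j) M (Equiv.injective _)
    (Equiv.swap i j x)
  rw [Equiv.swap_apply_self] at h1
  rw [h1]
  rcases eq_or_ne x i with rfl | hi
  · rw [Equiv.swap_apply_left, h]
  rcases eq_or_ne x j with rfl | hj
  · rw [Equiv.swap_apply_right, h]
  · rw [Equiv.swap_apply_of_ne_of_ne hi hj]

theorem IsDotAntisymm.lowerProd {ℓ : ℕ} {i j : Fin ℓ} {F : SymmFamily ℓ}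
    (hF : IsDotAntisymm i j F) {M : Multiset (Fin ℓ)} (hM : M.count i = M.count j) :
    IsDotAntisymm i j (lowerProd M F) := fun γ => by
  rw [hF.lowerProd_dotSwap, map_swap_eq_self hM]

/-! ### Raising operators -/

/-- The operator `∏_{α ∈ Ψ} (1 - R_α)⁻¹`, applied to an arbitrary family. The value is a junk `0`
where the sum has infinitely many nonzero terms. -/
noncomputable def raiseOp {ℓ : ℕ} (Ψ : Finset (Fin ℓ × Fin ℓ)) (F : SymmFamily ℓ) : SymmFamily ℓ :=
  fun γ => ∑ᶠ n ∈ {n : Fin ℓ × Fin ℓ →₀ ℕ | n.support ⊆ Ψ}, F (γ + rootShift n)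

theorem rootShift_add {ℓ : ℕ} (m n : Fin ℓ × Fin ℓ →₀ ℕ) :
    rootShift (m + n) = rootShift m + rootShift n :=
  Finsupp.sum_add_index' (fun _ => zero_smul _ _) fun _ _ _ => add_smul _ _ _

theorem rootShift_single_one {ℓ : ℕ} (α : Fin ℓ × Fin ℓ) :
    rootShift (Finsupp.single α 1) = rootVec α := by
  simp [rootShift]

theorem raiseSeries_support_finite {ℓ : ℕ} {Ψ : Finset (Fin ℓ × Fin ℓ)}
    (hΨ : ∀ α ∈ Ψ, α.1 < α.2) (γ : Fin ℓ → ℤ) {S : Set (Fin ℓ × Fin ℓ →₀ ℕ)}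
    (hS : S ⊆ {n | n.support ⊆ Ψ}) :
    (S ∩ Function.support fun n => gDual (γ + rootShift n)).Finite :=
  (raiseSeries_finite Ψ hΨ γ).subset fun _ hn => ⟨hS hn.1, hn.2⟩

/-- The identity `(1 - R_α)⁻¹ = 1 + R_α (1 - R_α)⁻¹`. -/
theorem raiseSeries_erase {ℓ : ℕ} {Ψ : Finset (Fin ℓ × Fin ℓ)} (hΨ : ∀ α ∈ Ψ, α.1 < α.2)
    {α : Fin ℓ × Fin ℓ} (hα : α ∈ Ψ) (γ : Fin ℓ → ℤ) :
    raiseSeries Ψ γ = raiseSeries (Ψ.erase α) γ + raiseSeries Ψ (γ + rootVec α) := by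
  set S : Set (Fin ℓ × Fin ℓ →₀ ℕ) := {n | n.support ⊆ Ψ} with hS
  set S₀ : Set (Fin ℓ × Fin ℓ →₀ ℕ) := {n | n.support ⊆ Ψ.erase α} with hS₀
  have hsub : ∀ n ∈ S, Finsupp.single α 1 + n ∈ S := by
    intro n hn
    refine Finsupp.support_add.trans (Finset.union_subset ?_ hn)
    exact Finsupp.support_single_subset.trans (Finset.singleton_subset_iff.mpr hα)
  have hunion : S = S₀ ∪ (fun n => Finsupp.single α 1 + n) '' S := by
    ext n
    constructor
    · intro hn
      by_cases h : n α = 0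
      · left
        intro β hβ
        refine Finset.mem_erase.mpr ⟨?_, hn hβ⟩
        rintro rfl
        exact Finsupp.mem_support_iff.mp hβ h
      · right
        refine ⟨n - Finsupp.single α 1, fun β hβ => hn ?_, ?_⟩
        · rw [Finsupp.mem_support_iff, Finsupp.tsub_apply] at hβ
          rw [Finsupp.mem_support_iff]
          omega
        · refine add_tsub_cancel_of_le (Finsupp.single_le_iff.mpr ?_)
          omega
    · rintro (hn | ⟨m, hm, rfl⟩)
      · exact hn.trans (Finset.erase_subset _ _)
      · exact hsub m hm
  have hdisj : Disjoint S₀ ((fun n => Finsupp.single α 1 + n) '' S) := by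
    rw [Set.disjoint_left]
    rintro n hn ⟨m, hm, rfl⟩
    have : α ∈ Ψ.erase α := hn (Finsupp.mem_support_iff.mpr (by simp))
    simp at this
  have hinj : Set.InjOn (fun n : Fin ℓ × Fin ℓ →₀ ℕ => Finsupp.single α 1 + n) S :=
    fun _ _ _ _ h => add_left_cancel h
  have h1 : raiseSeries Ψ γ = ∑ᶠ n ∈ S₀ ∪ (fun n => Finsupp.single α 1 + n) '' S,
      gDual (γ + rootShift n) := by
    rw [← hunion]; rfl
  rw [h1, finsum_mem_union' hdisj
    (raiseSeries_support_finite hΨ γ fun n hn => hn.trans (Finset.erase_subset _ _))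
    (raiseSeries_support_finite hΨ γ (by rintro _ ⟨m, hm, rfl⟩; exact hsub m hm)),
    finsum_mem_image hinj]
  simp only [rootShift_add, rootShift_single_one, ← add_assoc]
  rfl

theorem oneSubLower_raiseSeries {ℓ : ℕ} {Ψ : Finset (Fin ℓ × Fin ℓ)} (hΨ : ∀ α ∈ Ψ, α.1 < α.2)
    (j : Fin ℓ) : oneSubLower j (raiseSeries Ψ) = raiseOp Ψ (oneSubLower j gDual) := by
  funext γ
  have h1 := raiseSeries_support_finite (S := {n | n.support ⊆ Ψ}) hΨ γ subset_rfl
  have h2 := raiseSeries_support_finite (S := {n | n.support ⊆ Ψ}) hΨ (γ - Pi.single j 1)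
    subset_rfl
  have h := finsum_mem_add_distrib' (s := {n : Fin ℓ × Fin ℓ →₀ ℕ | n.support ⊆ Ψ})
    (f := fun n => gDual (γ + rootShift n) - gDual (γ - Pi.single j 1 + rootShift n))
    (g := fun n => gDual (γ - Pi.single j 1 + rootShift n))
    ((h1.union h2).subset ?_) h2
  · simp only [sub_add_cancel] at h
    change raiseSeries Ψ γ - raiseSeries Ψ (γ - Pi.single j 1) = _
    rw [raiseSeries, raiseSeries, h, add_sub_cancel_right]
    simp only [raiseOp, oneSubLower, lowerOp, Pi.sub_apply, ← sub_add_eq_add_sub]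
  · rintro n ⟨hn, hne⟩
    by_contra hc
    simp only [Set.mem_union, Set.mem_inter_iff, hn, true_and, Function.mem_support, not_or,
      not_not] at hc
    exact hne (by simp only [hc.1, hc.2, sub_zero])

theorem rootVec_comp_swap {ℓ : ℕ} (i j : Fin ℓ) (α : Fin ℓ × Fin ℓ) :
    rootVec α ∘ Equiv.swap i j =
      rootVec ((Equiv.swap i j).prodCongr (Equiv.swap i j) α) := by
  have h : rootVec α ∘ Equiv.swap i j = (Pi.single α.1 1 : Fin ℓ → ℤ) ∘ Equiv.swap i j -
      (Pi.single α.2 1 : Fin ℓ → ℤ) ∘ Equiv.swap i j := rfl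
  rw [h, single_comp_swap, single_comp_swap]
  rfl

theorem rootShift_comp_swap {ℓ : ℕ} (i j : Fin ℓ) (n : Fin ℓ × Fin ℓ →₀ ℕ) :
    rootShift n ∘ Equiv.swap i j =
      rootShift (n.equivMapDomain ((Equiv.swap i j).prodCongr (Equiv.swap i j))) := by
  induction n using Finsupp.induction_linear with
  | zero => simp [rootShift]
  | add m n hm hn =>
    have h : (rootShift m + rootShift n) ∘ Equiv.swap i j =
      rootShift m ∘ Equiv.swap i j + rootShift n ∘ Equiv.swap i j := rfl
    rw [Finsupp.equivMapDomain_eq_mapDomain] at hm hn ⊢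
    rw [Finsupp.mapDomain_add, rootShift_add, rootShift_add, h, hm, hn]
  | single α c =>
    rw [Finsupp.equivMapDomain_single]
    simp only [rootShift, zero_smul, Finsupp.sum_single_index, ← rootVec_comp_swap]
    rfl

theorem IsDotAntisymm.raiseOp {ℓ : ℕ} {i j : Fin ℓ} {F : SymmFamily ℓ}
    (hF : IsDotAntisymm i j F) {Ψ : Finset (Fin ℓ × Fin ℓ)}
    (hΨ : ∀ a b, (a, b) ∈ Ψ → (Equiv.swap i j a, Equiv.swap i j b) ∈ Ψ) :
    IsDotAntisymm i j (raiseOp Ψ F) := by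
  intro γ
  set e := (Equiv.swap i j).prodCongr (Equiv.swap i j)
  have he : ∀ α, e (e α) = α := fun α => by
    simp [e, Prod.map]
  have hee : ∀ n : Fin ℓ × Fin ℓ →₀ ℕ, (n.equivMapDomain e).equivMapDomain e = n := fun n => by
    ext1 α
    rw [Finsupp.equivMapDomain_apply, Finsupp.equivMapDomain_apply]
    congr 1
    rw [Equiv.symm_apply_eq, Equiv.symm_apply_eq, he]
  have hmem : ∀ n : Fin ℓ × Fin ℓ →₀ ℕ, n.support ⊆ Ψ → (n.equivMapDomain e).support ⊆ Ψ := by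
    intro n hn α hα
    rw [Finsupp.mem_support_iff, Finsupp.equivMapDomain_apply] at hα
    have := hΨ _ _ (hn (Finsupp.mem_support_iff.mpr hα))
    have h2 : e (e.symm α) ∈ Ψ := this
    rwa [Equiv.apply_symm_apply] at h2
  have h : _root_.raiseOp Ψ F (dotSwap i j γ) =
      ∑ᶠ n ∈ {n : Fin ℓ × Fin ℓ →₀ ℕ | n.support ⊆ Ψ}, -F (γ + rootShift n) := by
    refine (finsum_mem_eq_of_bijOn (fun n => n.equivMapDomain e) ⟨fun n hn => hmem n hn, ?_, ?_⟩
      ?_).symm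
    · intro m _ n _ hmn
      rw [← hee m, ← hee n]
      exact congrArg _ hmn
    · exact fun n hn => ⟨n.equivMapDomain e, hmem n hn, hee n⟩
    · intro n _
      rw [← hF, dotSwap_add, rootShift_comp_swap]
  rw [h]
  simp only [_root_.raiseOp, finsum_neg_distrib]

/-! ### Identities between Katalan functions -/

theorem katalan_cons {ℓ : ℕ} (Ψ : Finset (Fin ℓ × Fin ℓ)) (x : Fin ℓ) (M : Multiset (Fin ℓ))
    (γ : Fin ℓ → ℤ) :
    katalan Ψ (x ::ₘ M) γ = katalan Ψ M γ - lowerOp x (katalan Ψ M) γ := by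
  rw [katalan, lowerProd_cons]
  rfl

theorem katalan_erase {ℓ : ℕ} {Ψ : Finset (Fin ℓ × Fin ℓ)} (hΨ : ∀ α ∈ Ψ, α.1 < α.2)
    {α : Fin ℓ × Fin ℓ} (hα : α ∈ Ψ) (M : Multiset (Fin ℓ)) (γ : Fin ℓ → ℤ) :
    katalan Ψ M γ = katalan (Ψ.erase α) M γ + katalan Ψ M (γ + rootVec α) := by
  have h : raiseSeries Ψ =
      raiseSeries (Ψ.erase α) + fun δ => raiseSeries Ψ (δ + rootVec α) :=
    funext fun δ => raiseSeries_erase hΨ hα δ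
  conv_lhs => rw [katalan, h, lowerProd_add]
  rw [Pi.add_apply, lowerProd_translate]
  rfl

/-- Here the factor `1 - L_j` with `j = i + 1` is applied to `g` first, which makes it
antisymmetric; the remaining operators are symmetric in `i` and `j`. -/
theorem katalan_eq_zero {ℓ : ℕ} {Ψ : Finset (Fin ℓ × Fin ℓ)} (hΨ : ∀ α ∈ Ψ, α.1 < α.2)
    {M : Multiset (Fin ℓ)} {γ : Fin ℓ → ℤ} {i j : Fin ℓ} (hij : (j : ℕ) = i + 1)
    (hrow : ∀ x, (i, x) ∈ Ψ ↔ (j, x) ∈ Ψ) (hcol : ∀ x, x < i → ((x, i) ∈ Ψ ↔ (x, j) ∈ Ψ))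
    (hM : M.count j = M.count i + 1) (hγ : γ i = γ j - 1) : katalan Ψ M γ = 0 := by
  have hne : i ≠ j := by rintro rfl; omega
  have hcol' : ∀ x, (x, i) ∈ Ψ ↔ (x, j) ∈ Ψ := by
    intro x
    rcases lt_or_ge x i with hx | hx
    · exact hcol x hx
    have hjj : (j, j) ∉ Ψ := fun h => lt_irrefl _ (hΨ _ h)
    refine iff_of_false (fun h => (hΨ _ h).not_ge hx) fun h => ?_
    have h1 : x < j := hΨ _ h
    have h2 : x = i := by
      have := Fin.le_def.mp hx
      have := Fin.lt_def.mp h1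
      exact Fin.ext (by omega)
    subst h2
    exact hjj ((hrow j).mp h)
  have hfst : ∀ a b, (a, b) ∈ Ψ → (Equiv.swap i j a, b) ∈ Ψ := by
    intro a b h
    rcases eq_or_ne a i with rfl | hi
    · rw [Equiv.swap_apply_left]; exact (hrow b).mp h
    rcases eq_or_ne a j with rfl | hj
    · rw [Equiv.swap_apply_right]; exact (hrow b).mpr h
    · rwa [Equiv.swap_apply_of_ne_of_ne hi hj]
  have hsnd : ∀ a b, (a, b) ∈ Ψ → (a, Equiv.swap i j b) ∈ Ψ := by
    intro a b h
    rcases eq_or_ne b i with rfl | hi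
    · rw [Equiv.swap_apply_left]; exact (hcol' a).mp h
    rcases eq_or_ne b j with rfl | hj
    · rw [Equiv.swap_apply_right]; exact (hcol' a).mpr h
    · rwa [Equiv.swap_apply_of_ne_of_ne hi hj]
  have hmem : j ∈ M := Multiset.count_pos.mp (by omega)
  obtain ⟨M', rfl⟩ := Multiset.exists_cons_of_mem hmem
  rw [Multiset.count_cons_self, Multiset.count_cons_of_ne hne] at hM
  rw [katalan, lowerProd_cons', oneSubLower_raiseSeries hΨ]
  exact (((isDotAntisymm_oneSubLower_gDual hij).raiseOp
    fun a b h => hsnd _ _ (hfst _ _ h)).lowerProd (by omega)).eq_zero hne hγ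

/-! ### The root ideal and the weight multiset of a bounded partition -/

/-- The column of the first root in row `i` of `Δ^k(λ)`, as an integer: the row is empty if this is
not an element of `Fin ℓ`. -/
def rowStart (k : ℕ) {ℓ : ℕ} (lam : Fin ℓ → ℤ) (i : Fin ℓ) : ℤ :=
  k - lam i + i + 1

section

variable {k ℓ : ℕ} {lam : Fin ℓ → ℤ}

theorem IsBoundedPartition.lt_rowStart (h : IsBoundedPartition k lam) (i : Fin ℓ) :
    (i : ℤ) < rowStart k lam i := by
  have := (h.2 i).2
  unfold rowStart
  omega

theorem IsBoundedPartition.rowStart_strictMono (h : IsBoundedPartition k lam) :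
    StrictMono (rowStart k lam) := by
  intro i j hij
  have h1 := h.1 hij.le
  have h2 : (i : ℕ) < j := hij
  unfold rowStart
  omega

theorem IsBoundedPartition.mem_rootIdealOf (h : IsBoundedPartition k lam) {i j : Fin ℓ} :
    (i, j) ∈ rootIdealOf k lam ↔ rowStart k lam i ≤ j := by
  have h1 := h.lt_rowStart i
  simp only [rootIdealOf, Finset.mem_filter, Finset.mem_univ, true_and, Fin.lt_def]
  unfold rowStart at *
  omega

theorem rootIdealOf_lt {α : Fin ℓ × Fin ℓ} (h : α ∈ rootIdealOf k lam) : α.1 < α.2 :=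
  (Finset.mem_filter.mp h).2.1

theorem IsBoundedPartition.isRemovable_iff (h : IsBoundedPartition k lam) {i j : Fin ℓ} :
    IsRemovable (rootIdealOf k lam) (i, j) ↔ rowStart k lam i = j := by
  constructor
  · rintro ⟨hmem, hid⟩
    rw [h.mem_rootIdealOf] at hmem
    by_contra hne
    have h1 := h.lt_rowStart i
    let s : Fin ℓ := ⟨(rowStart k lam i).toNat, by omega⟩
    have hs : (s : ℤ) = rowStart k lam i := by simp only [s]; omega
    have h2 : (i, s) ∈ (rootIdealOf k lam).erase (i, j) := by
      refine Finset.mem_erase.mpr ⟨fun h3 => ?_, h.mem_rootIdealOf.mpr hs.ge⟩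
      rw [show s = j from (Prod.ext_iff.mp h3).2] at hs
      exact hne hs.symm
    have h3 := hid.2 _ h2 (i, j) (Fin.lt_def.mpr (by dsimp only; omega)) le_rfl
      (Fin.le_def.mpr (by dsimp only; omega))
    exact Finset.notMem_erase _ _ h3
  · intro hj
    refine ⟨h.mem_rootIdealOf.mpr hj.le, fun α hα => rootIdealOf_lt (Finset.mem_of_mem_erase hα),
      ?_⟩
    rintro ⟨a, b⟩ hab ⟨c, d⟩ _ hca hbd
    obtain ⟨hne, hab⟩ := Finset.mem_erase.mp hab
    rw [h.mem_rootIdealOf] at hab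
    have h1 := h.rowStart_strictMono.monotone hca
    have h2 : (b : ℤ) ≤ d := by exact_mod_cast Fin.le_def.mp hbd
    dsimp only at h1
    refine Finset.mem_erase.mpr ⟨fun he => ?_, h.mem_rootIdealOf.mpr (by omega)⟩
    obtain ⟨rfl, rfl⟩ := Prod.ext_iff.mp he
    dsimp only at *
    rcases hca.lt_or_eq with hlt | rfl
    · have := h.rowStart_strictMono hlt
      omega
    · refine hne (Prod.ext rfl (Fin.ext ?_))
      dsimp only
      omega

theorem IsBoundedPartition.down_eq_some_iff (h : IsBoundedPartition k lam) {i j : Fin ℓ} :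
    down (rootIdealOf k lam) i = some j ↔ rowStart k lam i = j := by
  rw [← h.isRemovable_iff, down]
  split_ifs with he
  · rw [Option.some_inj]
    exact ⟨fun hj => hj ▸ he.choose_spec, fun hj => he.choose_spec.snd_unique hj⟩
  · exact iff_of_false (by simp) fun hj => he ⟨j, hj⟩

theorem IsBoundedPartition.lt_bottom_iff (h : IsBoundedPartition k lam) {i : Fin ℓ} :
    (i : ℕ) < bottom (rootIdealOf k lam) ↔ rowStart k lam i < ℓ := by
  rw [bottom, Finset.lt_sup_iff]
  constructor
  · rintro ⟨⟨a, b⟩, hab, hi⟩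
    have h1 := h.rowStart_strictMono.monotone (Fin.le_def.mpr (by dsimp only at hi; omega) : i ≤ a)
    rw [h.mem_rootIdealOf] at hab
    omega
  · intro hi
    have := h.lt_rowStart i
    exact ⟨(i, ⟨(rowStart k lam i).toNat, by omega⟩),
      h.mem_rootIdealOf.mpr (by dsimp only; omega), by dsimp only; omega⟩

/-- The roots of `Δ^k(λ)` other than the removable roots of the rows from `z` on: the weight
multiset consists of their second components. -/
def weightRoots (k : ℕ) {ℓ : ℕ} (lam : Fin ℓ → ℤ) (z : Fin ℓ) : Finset (Fin ℓ × Fin ℓ) :=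
  Finset.univ.filter fun α =>
    rowStart k lam α.1 ≤ α.2 ∧ ¬ (z ≤ α.1 ∧ rowStart k lam α.1 = α.2)

theorem mem_weightRoots {z i j : Fin ℓ} : (i, j) ∈ weightRoots k lam z ↔
    rowStart k lam i ≤ j ∧ ¬ (z ≤ i ∧ rowStart k lam i = j) := by
  simp [weightRoots]

theorem IsBoundedPartition.weightMultiset_eq (h : IsBoundedPartition k lam) (z : Fin ℓ) :
    weightMultiset k lam z = (weightRoots k lam z).val.map Prod.snd := by
  let T : Finset (Fin ℓ × Fin ℓ) :=
    (rootIdealOf k lam).filter fun α => z ≤ α.1 ∧ rowStart k lam α.1 = α.2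
  have hW : weightRoots k lam z =
      (rootIdealOf k lam).filter fun α => ¬ (z ≤ α.1 ∧ rowStart k lam α.1 = α.2) := by
    ext ⟨i, j⟩
    rw [mem_weightRoots, Finset.mem_filter, h.mem_rootIdealOf]
  have hS : secondComponents (rootIdealOf k lam) =
      T.val.map Prod.snd + (weightRoots k lam z).val.map Prod.snd := by
    rw [hW, ← Multiset.map_add, Finset.filter_val, Finset.filter_val,
      Multiset.filter_add_not]
    rfl
  have hT : (Finset.univ.filter fun x : Fin ℓ =>
      z ≤ x ∧ (x : ℕ) + 1 ≤ bottom (rootIdealOf k lam)).val.filterMap (down (rootIdealOf k lam)) =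
      T.val.map Prod.snd := by
    refine (Multiset.Nodup.ext (Multiset.Nodup.filterMap _ ?_ (Finset.nodup _))
      (Multiset.Nodup.map_on ?_ T.nodup)).mpr ?_
    · intro a a' b ha ha'
      exact h.rowStart_strictMono.injective
        ((h.down_eq_some_iff.mp ha).trans (h.down_eq_some_iff.mp ha').symm)
    · intro α hα β hβ hαβ
      have h1 := (Finset.mem_filter.mp hα).2.2
      have h2 := (Finset.mem_filter.mp hβ).2.2
      exact Prod.ext (h.rowStart_strictMono.injective (by rw [h1, h2, hαβ])) hαβ
    · intro j
      simp only [Multiset.mem_filterMap, Multiset.mem_map, Finset.mem_val, Finset.mem_filter,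
        Finset.mem_univ, true_and, h.down_eq_some_iff, Nat.succ_le_iff, h.lt_bottom_iff,
        Prod.exists, exists_eq_right, T, h.mem_rootIdealOf]
      exact exists_congr fun i => by omega
  rw [weightMultiset, hS, hT, add_tsub_cancel_left]

/-- On a column `c = down(w)` with `z ≤ w` the weight multiset loses the root `(w, c)`, which
column `c + 1` keeps; any root of column `c + 1` without a left neighbour lies in a row below
`w`, hence is removable, and is lost as well. -/
theorem IsBoundedPartition.count_weightMultiset_succ (h : IsBoundedPartition k lam)
    {z w i j : Fin ℓ} (hzw : z ≤ w) (hw : rowStart k lam w = i) (hij : (j : ℕ) = i + 1) :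
    (weightMultiset k lam z).count j = (weightMultiset k lam z).count i + 1 := by
  have hcount : ∀ x : Fin ℓ, (weightMultiset k lam z).count x =
      (Finset.univ.filter fun a : Fin ℓ => (a, x) ∈ weightRoots k lam z).card := by
    intro x
    have h1 : (weightRoots k lam z).filter (fun α => x = α.2) =
        (Finset.univ.filter fun a : Fin ℓ => (a, x) ∈ weightRoots k lam z).map
          ⟨fun a => (a, x), fun a b hab => (Prod.ext_iff.mp hab).1⟩ := by
      ext ⟨a, b⟩
      simp only [Finset.mem_filter, Finset.mem_map, Finset.mem_univ, true_and]
      constructor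
      · rintro ⟨h1, rfl⟩; exact ⟨a, h1, rfl⟩
      · rintro ⟨c, h1, h2⟩; cases h2; exact ⟨h1, rfl⟩
    rw [h.weightMultiset_eq, Multiset.count_map, ← Finset.filter_val, Finset.card_val, h1,
      Finset.card_map]
  have hins : (Finset.univ.filter fun a : Fin ℓ => (a, j) ∈ weightRoots k lam z) =
      insert w (Finset.univ.filter fun a : Fin ℓ => (a, i) ∈ weightRoots k lam z) := by
    ext a
    simp only [Finset.mem_insert, Finset.mem_filter, Finset.mem_univ, true_and, mem_weightRoots]
    rcases lt_trichotomy a w with ha | rfl | ha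
    · have := h.rowStart_strictMono ha
      have h3 : a ≠ w := ha.ne
      simp only [h3, false_or]
      omega
    · simp only [true_or, iff_true]
      omega
    · have := h.rowStart_strictMono ha
      have h3 : a ≠ w := ha.ne'
      have h4 : z ≤ a := hzw.trans ha.le
      simp only [h3, h4, false_or, true_and]
      omega
  rw [hcount, hcount, hins, Finset.card_insert_of_notMem]
  simp only [Finset.mem_filter, Finset.mem_univ, true_and, mem_weightRoots]
  exact fun h1 => h1.2 ⟨hzw, hw⟩

theorem IsBoundedPartition.downIter_succ (h : IsBoundedPartition k lam) {a : ℕ} {z x : Fin ℓ}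
    (hx : downIter (rootIdealOf k lam) (a + 1) z = some x) :
    ∃ w, downIter (rootIdealOf k lam) a z = some w ∧ rowStart k lam w = x := by
  obtain ⟨w, hw, hwx⟩ := Option.bind_eq_some_iff.mp hx
  exact ⟨w, hw, h.down_eq_some_iff.mp hwx⟩

theorem IsBoundedPartition.le_of_downIter (h : IsBoundedPartition k lam) {a : ℕ} {z x : Fin ℓ}
    (hx : downIter (rootIdealOf k lam) a z = some x) : z ≤ x := by
  induction a generalizing x with
  | zero => exact (Option.some_inj.mp hx).le
  | succ a ih =>
    obtain ⟨w, hw, hwx⟩ := h.downIter_succ hx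
    have := h.lt_rowStart w
    exact (ih hw).trans (Fin.le_def.mpr (by omega))

/-! ### Lowering one part of the partition -/

theorem rowStart_sub_single (y i : Fin ℓ) :
    rowStart k (lam - Pi.single y 1) i = rowStart k lam i + if i = y then 1 else 0 := by
  simp only [rowStart, Pi.sub_apply, Pi.single_apply]
  split_ifs <;> ring

theorem IsBoundedPartition.rootIdealOf_sub_single (h : IsBoundedPartition k lam) {y y' : Fin ℓ}
    (hγ : IsBoundedPartition k (lam - Pi.single y 1)) (hy : rowStart k lam y = y') :
    rootIdealOf k (lam - Pi.single y 1) = (rootIdealOf k lam).erase (y, y') := by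
  ext ⟨i, j⟩
  rw [Finset.mem_erase, h.mem_rootIdealOf, hγ.mem_rootIdealOf, rowStart_sub_single]
  rcases eq_or_ne i y with rfl | hi
  · simp only [if_true, ne_eq, Prod.mk.injEq, true_and, Fin.ext_iff]
    omega
  · simp [hi]

theorem IsBoundedPartition.downIter_sub_single (h : IsBoundedPartition k lam) {y : Fin ℓ}
    (hγ : IsBoundedPartition k (lam - Pi.single y 1)) {a : ℕ} {z x : Fin ℓ} (hxy : x ≤ y)
    (hx : downIter (rootIdealOf k lam) a z = some x) :
    downIter (rootIdealOf k (lam - Pi.single y 1)) a z = some x := by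
  induction a generalizing x with
  | zero => exact hx
  | succ a ih =>
    obtain ⟨w, hw, hwx⟩ := h.downIter_succ hx
    have h1 := h.lt_rowStart w
    have h2 : w < y := lt_of_lt_of_le (Fin.lt_def.mpr (by omega)) hxy
    refine Option.bind_eq_some_iff.mpr ⟨w, ih h2.le hw, hγ.down_eq_some_iff.mpr ?_⟩
    rw [rowStart_sub_single, if_neg h2.ne, add_zero, hwx]

/-- Row `y` of `Δ^k(λ - ε_y)` starts one column further to the right. If that column exists, it is
the one lost from the weight multiset. -/
theorem IsBoundedPartition.weightMultiset_sub_single (h : IsBoundedPartition k lam) {y z : Fin ℓ}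
    (hγ : IsBoundedPartition k (lam - Pi.single y 1)) (hzy : z ≤ y) :
    weightMultiset k lam z =
      (down (rootIdealOf k (lam - Pi.single y 1)) y).elim 0 (fun x => {x}) +
        weightMultiset k (lam - Pi.single y 1) z := by
  have hrow := rowStart_sub_single (k := k) (lam := lam) y
  rw [h.weightMultiset_eq, hγ.weightMultiset_eq]
  rcases hd : down (rootIdealOf k (lam - Pi.single y 1)) y with _ | x
  · simp only [Option.elim, zero_add]
    congr 2
    ext ⟨i, j⟩
    rw [mem_weightRoots, mem_weightRoots, hrow]
    rcases eq_or_ne i y with rfl | hi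
    · have h1 : rowStart k (lam - Pi.single i 1) i ≠ j := fun h1 => by
        rw [hγ.down_eq_some_iff.mpr h1] at hd
        cases hd
      rw [hrow] at h1
      simp only [if_true, hzy, true_and] at h1 ⊢
      omega
    · simp [hi]
  · have hx := hγ.down_eq_some_iff.mp hd
    simp only [Option.elim]
    rw [hrow, if_pos rfl] at hx
    have hins : weightRoots k lam z =
        insert (y, x) (weightRoots k (lam - Pi.single y 1) z) := by
      ext ⟨i, j⟩
      rw [Finset.mem_insert, mem_weightRoots, mem_weightRoots, hrow]
      rcases eq_or_ne i y with rfl | hi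
      · simp only [if_true, hzy, true_and, Prod.mk.injEq, Fin.ext_iff]
        omega
      · simp [hi]
    have hnot : (y, x) ∉ weightRoots k (lam - Pi.single y 1) z := by
      rw [mem_weightRoots, hrow, if_pos rfl]
      exact fun h1 => h1.2 ⟨hzy, hx⟩
    rw [hins, Finset.insert_val_of_notMem hnot, Multiset.map_cons, Multiset.singleton_add]

/-! ### Vanishing along a path -/

/-- Let `y = down_λ^a(z)` with `a ≥ 1`. If rows `y` and `y + 1` of `Ψ` agree, and `Ψ` agrees with
`Δ^k(λ)` above row `y`, then columns `y` and `y + 1` agree as well, except when the row `w + 1`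
after `w = down_λ^(a-1)(z)` lies above row `y` and starts in column `y + 1`. Adding the root
`(w + 1, y)` repairs this, and the correction term has equal rows `w` and `w + 1`: it vanishes by
induction on `a`. The inequality `λ_z > λ_{z+1}` excludes the exception for `a = 1`. -/
theorem IsBoundedPartition.katalan_eq_zero (h : IsBoundedPartition k lam) {z : Fin ℓ}
    (hz : ∀ z₁ : Fin ℓ, (z₁ : ℕ) = (z : ℕ) + 1 → lam z₁ < lam z) {a : ℕ} {y y₁ : Fin ℓ}
    (hy : downIter (rootIdealOf k lam) (a + 1) z = some y) (hy₁ : (y₁ : ℕ) = y + 1)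
    {Ψ : Finset (Fin ℓ × Fin ℓ)} (hΨ : ∀ α ∈ Ψ, α.1 < α.2)
    (hΨrow : ∀ x, (y, x) ∈ Ψ ↔ (y₁, x) ∈ Ψ)
    (hΨlam : ∀ i x, i < y → ((i, x) ∈ Ψ ↔ rowStart k lam i ≤ x))
    {γ : Fin ℓ → ℤ} (hγ : γ y = γ y₁ - 1) (hγlam : ∀ i, i < y → γ i = lam i) :
    katalan Ψ (weightMultiset k lam z) γ = 0 := by
  induction a generalizing y y₁ Ψ γ with
  | zero =>
    obtain ⟨w, hw, hwy⟩ := h.downIter_succ hy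
    obtain rfl : z = w := Option.some_inj.mp hw
    refine _root_.katalan_eq_zero hΨ hy₁ hΨrow (fun i hi => ?_)
      (h.count_weightMultiset_succ le_rfl hwy hy₁) hγ
    rw [hΨlam i y hi, hΨlam i y₁ hi]
    have hle := Fin.lt_def.mp hi
    rcases le_or_gt i z with hiz | hiz
    · have := h.rowStart_strictMono.monotone hiz
      omega
    · have h1 := Fin.lt_def.mp hiz
      have h2 := hz ⟨z + 1, by omega⟩ rfl
      have h3 := h.rowStart_strictMono.monotone
        (Fin.le_def.mpr (by dsimp only; omega) : (⟨z + 1, by omega⟩ : Fin ℓ) ≤ i)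
      have h4 : rowStart k lam ⟨z + 1, by omega⟩ = k - lam ⟨z + 1, by omega⟩ + (z + 1) + 1 := by
        simp [rowStart]
      have h5 : rowStart k lam z = k - lam z + z + 1 := rfl
      omega
  | succ a ih =>
    obtain ⟨w, hw, hwy⟩ := h.downIter_succ hy
    have hzw := h.le_of_downIter hw
    have hcount := h.count_weightMultiset_succ hzw hwy hy₁
    have hwlt := h.lt_rowStart w
    let w₁ : Fin ℓ := ⟨w + 1, by omega⟩
    have hw₁ : (w₁ : ℕ) = w + 1 := rfl
    have hww₁ := h.rowStart_strictMono (Fin.lt_def.mpr (by omega) : w < w₁)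
    have hcol : ∀ i, i < y → i ≠ w₁ → (rowStart k lam i ≤ y ↔ rowStart k lam i ≤ y₁) := by
      intro i hi hne
      have hne' : (i : ℕ) ≠ w₁ := fun h1 => hne (Fin.ext h1)
      rcases le_or_gt i w with hiw | hiw
      · have := h.rowStart_strictMono.monotone hiw
        omega
      · have h1 := Fin.lt_def.mp hiw
        have := h.rowStart_strictMono (Fin.lt_def.mpr (by omega) : w₁ < i)
        omega
    -- If `w + 1 = y`, the two columns agree above row `y` in any case.
    by_cases hexc : w₁ < y ∧ rowStart k lam w₁ = y₁
    · obtain ⟨hw₁y, hst⟩ := hexc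
      have hw₁y' := Fin.lt_def.mp hw₁y
      have hnot : (w₁, y) ∉ Ψ := by
        rw [hΨlam _ _ hw₁y]
        omega
      let Φ := insert (w₁, y) Ψ
      have hΦ : ∀ α ∈ Φ, α.1 < α.2 := by
        intro α hα
        rcases Finset.mem_insert.mp hα with rfl | hα
        · exact hw₁y
        · exact hΨ α hα
      have hΦmem : ∀ i x, (i, x) ∈ Φ ↔ (i = w₁ ∧ x = y) ∨ (i, x) ∈ Ψ := by
        intro i x
        rw [Finset.mem_insert, Prod.mk.injEq]
      have hΦΨ : ∀ i x, i ≠ w₁ → ((i, x) ∈ Φ ↔ (i, x) ∈ Ψ) := by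
        intro i x hi
        simp [hΦmem, hi]
      have h1 := katalan_erase hΦ (Finset.mem_insert_self _ _) (weightMultiset k lam z) γ
      rw [Finset.erase_insert hnot] at h1
      have h2 : katalan Φ (weightMultiset k lam z) γ = 0 := by
        refine _root_.katalan_eq_zero hΦ hy₁ (fun x => ?_) (fun i hi => ?_) hcount hγ
        · rw [hΦΨ _ _ hw₁y.ne', hΦΨ, hΨrow]
          exact fun h3 => by have := congrArg Fin.val h3; omega
        · rcases eq_or_ne i w₁ with rfl | hne
          · refine iff_of_true (Finset.mem_insert_self _ _) (Finset.mem_insert_of_mem ?_)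
            rw [hΨlam _ _ hi, hst]
          · rw [hΦΨ _ _ hne, hΦΨ _ _ hne, hΨlam _ _ hi, hΨlam _ _ hi, hcol i hi hne]
      have hwy' : w < y := Fin.lt_def.mpr (by omega)
      have hne : w ≠ w₁ := fun h3 => by have := congrArg Fin.val h3; omega
      have h3 : katalan Φ (weightMultiset k lam z) (γ + rootVec (w₁, y)) = 0 := by
        refine ih hw hw₁ hΦ (fun x => ?_) (fun i x hi => ?_) ?_ fun i hi => ?_
        · rw [hΦΨ _ _ hne, hΦmem, hΨlam _ _ hwy', hΨlam _ _ hw₁y, hst, hwy, Fin.ext_iff,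
            Fin.ext_iff]
          omega
        · have hi' := Fin.lt_def.mp hi
          rw [hΦΨ, hΨlam _ _ (hi.trans hwy')]
          exact fun h3 => by have := congrArg Fin.val h3; omega
        · have e1 : rowStart k lam w₁ = k - lam w₁ + w₁ + 1 := rfl
          have e2 : rowStart k lam w = k - lam w + w + 1 := rfl
          simp only [Pi.add_apply, rootVec, Pi.sub_apply, Pi.single_eq_same,
            Pi.single_eq_of_ne hne, Pi.single_eq_of_ne hwy'.ne, Pi.single_eq_of_ne hw₁y.ne,
            hγlam _ hwy', hγlam _ hw₁y]
          omega
        · have hi' := Fin.lt_def.mp hi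
          have hiw₁ : i ≠ w₁ := fun h3 => by have := congrArg Fin.val h3; omega
          simp only [Pi.add_apply, rootVec, Pi.sub_apply, Pi.single_eq_of_ne hiw₁,
            Pi.single_eq_of_ne (hi.trans hwy').ne, hγlam _ (hi.trans hwy')]
          omega
      rw [h2, h3, add_zero] at h1
      exact h1.symm
    · refine _root_.katalan_eq_zero hΨ hy₁ hΨrow (fun i hi => ?_) hcount hγ
      rw [hΨlam i y hi, hΨlam i y₁ hi]
      rcases eq_or_ne i w₁ with rfl | hne
      · have : rowStart k lam w₁ ≠ y₁ := fun h1 => hexc ⟨hi, h1⟩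
        omega
      · exact hcol i hi hne

end

theorem proposition3p3 {k ℓ : ℕ} (lam : Fin ℓ → ℤ) (hlam : IsBoundedPartition k lam)
    (z : Fin ℓ) (hz : (z : ℕ) + 1 ∈ Finset.Icc 1 (bottom (rootIdealOf k lam) - 1))
    (a : ℕ) (ha : 1 ≤ a)
    (y : Fin ℓ) (hy : downIter (rootIdealOf k lam) a z = some y)
    (hyb : (y : ℕ) + 1 ∈ Finset.Icc 1 (bottom (rootIdealOf k lam)))
    (γ : Fin ℓ → ℤ) (hγ : γ = lam - Pi.single y 1) :
    ∃ y' : Fin ℓ, downIter (rootIdealOf k lam) (a + 1) z = some y' ∧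
      (IsBoundedPartition k γ →
        lowerWeightedKkSchur k (some y) lam z =
          weightedKkSchur k γ z
            - lowerWeightedKkSchur k (downIter (rootIdealOf k γ) (a + 1) z) γ z
            + lowerWeightedKkSchur k (some y') lam z) ∧
      (¬ IsBoundedPartition k γ →
        (∀ z₁ : Fin ℓ, (z₁ : ℕ) = (z : ℕ) + 1 → lam z₁ < lam z) →
        lowerWeightedKkSchur k (some y) lam z = lowerWeightedKkSchur k (some y') lam z) := by
  subst hγ
  have hylt : rowStart k lam y < ℓ :=
    hlam.lt_bottom_iff.mp (Nat.lt_of_succ_le (Finset.mem_Icc.mp hyb).2)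
  have hystart := hlam.lt_rowStart y
  obtain ⟨y', hy'⟩ : ∃ y' : Fin ℓ, rowStart k lam y = y' :=
    ⟨⟨(rowStart k lam y).toNat, by omega⟩, by dsimp only; omega⟩
  have hmem : (y, y') ∈ rootIdealOf k lam := hlam.mem_rootIdealOf.mpr hy'.le
  have hexp : lowerWeightedKkSchur k (some y) lam z =
      katalan ((rootIdealOf k lam).erase (y, y')) (weightMultiset k lam z)
        (lam - Pi.single y 1) + lowerWeightedKkSchur k (some y') lam z := by
    have h1 := katalan_erase (fun _ => rootIdealOf_lt) hmem (weightMultiset k lam z)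
      (lam - Pi.single y 1)
    have h2 : lam - Pi.single y 1 + rootVec (y, y') = lam - Pi.single y' 1 := by
      simp only [rootVec]; abel
    rwa [h2] at h1
  refine ⟨y', Option.bind_eq_some_iff.mpr ⟨y, hy, hlam.down_eq_some_iff.mpr hy'⟩, ?_, ?_⟩
  · intro hγ
    have hd : downIter (rootIdealOf k (lam - Pi.single y 1)) (a + 1) z =
        down (rootIdealOf k (lam - Pi.single y 1)) y := by
      rw [downIter, hlam.downIter_sub_single hγ le_rfl hy, Option.bind_some]
    rw [hexp, hd, hlam.weightMultiset_sub_single hγ (hlam.le_of_downIter hy),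
      ← hlam.rootIdealOf_sub_single hγ hy']
    congr 1
    rcases down (rootIdealOf k (lam - Pi.single y 1)) y with _ | x
    · simp only [Option.elim, zero_add, lowerWeightedKkSchur, sub_zero]
      rfl
    · simp only [Option.elim, Multiset.singleton_add, katalan_cons]
      rfl
  · intro hγ hzlt
    obtain ⟨a, rfl⟩ := Nat.exists_eq_add_of_le' ha
    have hlt := Fin.lt_def.mp (rootIdealOf_lt hmem)
    dsimp only at hlt
    let y₁ : Fin ℓ := ⟨y + 1, by omega⟩
    have hy₁ : (y₁ : ℕ) = y + 1 := rfl
    have hne : y₁ ≠ y := fun h => by have := congrArg Fin.val h; omega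
    have hle : lam y₁ ≤ lam y := hlam.1 (Fin.le_def.mpr (by omega))
    -- Lowering `λ_y` can only fail to give a bounded partition if the next part is equal.
    have heq : lam y₁ = lam y := by
      by_contra hne₁
      have h0 := (hlam.2 y₁).1
      refine hγ ⟨fun i j hij => ?_, fun i => ?_⟩
      · have h1 := hlam.1 hij
        simp only [Pi.sub_apply, Pi.single_apply]
        rcases eq_or_ne i y with rfl | hi
        · rcases eq_or_ne j i with rfl | hj
          · exact le_rfl
          · have h2 := Fin.le_def.mp hij
            have h3 : (j : ℕ) ≠ i := fun h3 => hj (Fin.ext h3)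
            have h4 := hlam.1 (Fin.le_def.mpr (by omega) : y₁ ≤ j)
            simp only [if_true, hj, if_false]
            omega
        · simp only [hi, if_false]
          split_ifs <;> omega
      · have h1 := hlam.2 i
        simp only [Pi.sub_apply, Pi.single_apply]
        split_ifs with hi
        · subst hi
          omega
        · omega
    have hst : rowStart k lam y₁ = y' + 1 := by
      rw [← hy']
      simp only [rowStart, heq, hy₁]
      push_cast
      ring
    rw [hexp, add_eq_right]
    refine hlam.katalan_eq_zero hzlt hy hy₁
      (fun α hα => rootIdealOf_lt (Finset.mem_of_mem_erase hα)) (fun x => ?_)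
      (fun i x hi => ?_) ?_ fun i hi => ?_
    · simp only [Finset.mem_erase, hlam.mem_rootIdealOf, hy', hst, ne_eq, Prod.mk.injEq, true_and,
        hne, false_and, not_false_eq_true, Fin.ext_iff]
      omega
    · simp [Finset.mem_erase, hlam.mem_rootIdealOf, hi.ne]
    · simp [hne, heq]
    · simp [hi.ne]
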